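/- Let $r\ge 0$ be an integer. A \emph{finite graph} $G=(G_0,\widetilde G_1)$ consists of a finite set $G_0$ of vertices, a finite set $G_1$ of edges, a two-fold covering $\widetilde G_1\to G_1$ (the half-edges) with sheet-switching involution $\tau$, and an incidence map $\partial:\widetilde G_1\to G_0$ (loops and multiple edges are allowed). Extend $\tau$ and $\partial$ to $G_0\amalg\widetilde G_1$ by the identity on $G_0$. A \emph{graph monomorphism} $G\to G'$ is an injective map $f:G_0\amalg\widetilde G_1\to G'_0\amalg\widetilde G'_1$ which commutes with $\tau$ and $\partial$ and satisfies $f(G_0)=G'_0$ and $f(\widetilde G_1)\subseteq\widetilde G'_1$. Let $m\mathcal G(r)$ be the category of connected finite graphs with $r+1$ vertices and graph monomorphisms, and let $\mathcal S(r+1)$ be the category of sets with $r+1$ elements and bijections. For a category $\mathcal C$ let $B\mathcal C$ be its classifying space, the geometric realization of its nerve, and for a group $\Gamma$ let $B\Gamma$ be the classifying space of the category with one object and morphism group $\Gamma$. Let $V:m\mathcal G(r)\to\mathcal S(r+1)$ be the vertex functor $G\mapsto G_0$, and let $K:\mathcal S(r+1)\to m\mathcal G(r)$ be the functor which sends a set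 $S$ to the complete graph on $S$, whose edges are the two-element subsets of $S$ and whose half-edges are the ordered pairs of distinct elements of $S$. \textbf{Theorem.} The map $BV:Bm\mathcal G(r)\to B\mathcal S(r+1)$ is a homotopy equivalence with homotopy inverse $BK$. Moreover, the inclusion of the symmetric group $S_{r+1}$ in $\mathcal S(r+1)$ as the automorphism group of a standard set with $r+1$ elements induces a homotopy equivalence $BS_{r+1}\simeq B\mathcal S(r+1)$. Hence $$Bm\mathcal G(r)\simeq B\mathcal S(r+1)\simeq BS_{r+1}.$$ -/

import Mathlib

open CategoryTheory ContinuousMap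

universe u

/-- A finite graph (loops and multiple edges allowed): a finite set `V` of vertices, a finite set
`E` of edges, a two-fold covering `edge : H → E` of half-edges, and an incidence map `bd : H → V`.
The switch `tau` of the two sheets is determined by the covering: by the fields below the fibre of
`edge` containing `h` consists exactly of the two distinct elements `h` and `tau h`. -/
structure HalfEdgeGraph : Type (u + 1) where
  V : Type u
  E : Type u
  H : Type u
  [finiteV : Finite V]
  [finiteE : Finite E]
  edge : H → E
  edge_surjective : Function.Surjective edge
  tau : H → H
  edge_tau : ∀ h, edge (tau h) = edge h
  tau_ne : ∀ h, tau h ≠ h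
  eq_or_eq_tau : ∀ h k, edge k = edge h → k = h ∨ k = tau h
  bd : H → V

namespace HalfEdgeGraph

/-- The involution `τ` extended to `V ∐ H` by the identity on vertices. -/
def tauAll (G : HalfEdgeGraph.{u}) : G.V ⊕ G.H → G.V ⊕ G.H :=
  Sum.elim Sum.inl (fun h => Sum.inr (G.tau h))

/-- The incidence map `∂` extended to `V ∐ H` by the identity on vertices. -/
def bdAll (G : HalfEdgeGraph.{u}) : G.V ⊕ G.H → G.V ⊕ G.H :=
  Sum.elim Sum.inl (fun h => Sum.inl (G.bd h))

/-- A graph monomorphism `G → G'`: an injective map `V ∐ H → V' ∐ H'` commuting with `τ` and `∂`,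
mapping the vertices onto the vertices and half-edges to half-edges. -/
@[ext]
structure Mono (G G' : HalfEdgeGraph.{u}) : Type u where
  toFun : G.V ⊕ G.H → G'.V ⊕ G'.H
  map_tau : ∀ x, toFun (G.tauAll x) = G'.tauAll (toFun x)
  map_bd : ∀ x, toFun (G.bdAll x) = G'.bdAll (toFun x)
  injective : Function.Injective toFun
  image_vertices : toFun '' Set.range Sum.inl = Set.range Sum.inl
  image_halfEdges : toFun '' Set.range Sum.inr ⊆ Set.range Sum.inr

namespace Mono

/-- The identity monomorphism. -/
def id (G : HalfEdgeGraph.{u}) : Mono G G where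
  toFun := _root_.id
  map_tau _ := rfl
  map_bd _ := rfl
  injective := Function.injective_id
  image_vertices := Set.image_id _
  image_halfEdges := (Set.image_id _).subset

/-- Composition of monomorphisms. -/
def comp {G G' G'' : HalfEdgeGraph.{u}} (f : Mono G G') (g : Mono G' G'') : Mono G G'' where
  toFun := g.toFun ∘ f.toFun
  map_tau x := by simp [f.map_tau, g.map_tau]
  map_bd x := by simp [f.map_bd, g.map_bd]
  injective := g.injective.comp f.injective
  image_vertices := by rw [Set.image_comp, f.image_vertices, g.image_vertices]
  image_halfEdges := by
    rw [Set.image_comp]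
    exact (Set.image_mono f.image_halfEdges).trans g.image_halfEdges

/-- The map on vertices underlying a monomorphism (see `toFun_inl`). -/
def vertexMap {G G' : HalfEdgeGraph.{u}} (f : Mono G G') (v : G.V) : G'.V :=
  Sum.elim _root_.id G'.bd (f.toFun (Sum.inl v))

theorem toFun_inl {G G' : HalfEdgeGraph.{u}} (f : Mono G G') (v : G.V) :
    f.toFun (Sum.inl v) = Sum.inl (f.vertexMap v) := by
  have h : f.toFun (Sum.inl v) ∈ Set.range (Sum.inl : G'.V → G'.V ⊕ G'.H) := by
    rw [← f.image_vertices]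
    exact ⟨_, ⟨v, rfl⟩, rfl⟩
  obtain ⟨w, hw⟩ := h
  simp [vertexMap, ← hw]

theorem vertexMap_bijective {G G' : HalfEdgeGraph.{u}} (f : Mono G G') :
    Function.Bijective f.vertexMap := by
  constructor
  · intro v w h
    have : f.toFun (Sum.inl v) = f.toFun (Sum.inl w) := by rw [toFun_inl, toFun_inl, h]
    exact Sum.inl_injective (f.injective this)
  · intro w
    have h : (Sum.inl w : G'.V ⊕ G'.H) ∈ f.toFun '' Set.range Sum.inl := by
      rw [f.image_vertices]
      exact ⟨w, rfl⟩
    obtain ⟨_, ⟨v, rfl⟩, hv⟩ := h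
    rw [toFun_inl] at hv
    exact ⟨v, Sum.inl_injective hv⟩

theorem comp_vertexMap {G G' G'' : HalfEdgeGraph.{u}} (f : Mono G G') (g : Mono G' G'') (v : G.V) :
    (f.comp g).vertexMap v = g.vertexMap (f.vertexMap v) := by
  have h : (f.comp g).toFun (Sum.inl v) = g.toFun (f.toFun (Sum.inl v)) := rfl
  rw [toFun_inl, toFun_inl, toFun_inl] at h
  exact Sum.inl_injective h

end Mono

/-- A graph is connected if it has a vertex and any two vertices are joined by an edge path. -/
def Connected (G : HalfEdgeGraph.{u}) : Prop :=
  Nonempty G.V ∧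
    ∀ v w : G.V, Relation.ReflTransGen (fun a b => ∃ h : G.H, G.bd h = a ∧ G.bd (G.tau h) = b) v w

/-- The complete graph on a finite set `S`: edges are the two-element subsets of `S` (encoded as
non-diagonal unordered pairs), half-edges are the ordered pairs of distinct elements. -/
def complete (S : Type u) [Finite S] : HalfEdgeGraph.{u} where
  V := S
  E := {e : Sym2 S // ¬ e.IsDiag}
  H := {p : S × S // p.1 ≠ p.2}
  edge p := ⟨s(p.1.1, p.1.2), fun h => p.2 (Sym2.mk_isDiag_iff.1 h)⟩
  edge_surjective := by
    rintro ⟨e, he⟩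
    induction e using Sym2.ind with
    | _ a b => exact ⟨⟨(a, b), fun h => he (Sym2.mk_isDiag_iff.2 h)⟩, rfl⟩
  tau p := ⟨(p.1.2, p.1.1), p.2.symm⟩
  edge_tau p := Subtype.ext Sym2.eq_swap
  tau_ne p h := p.2 (congrArg (fun q => q.1.2) h)
  eq_or_eq_tau := by
    rintro ⟨⟨a, b⟩, h⟩ ⟨⟨c, d⟩, k⟩ e
    simpa using e
  bd p := p.1.1

theorem complete_connected (S : Type u) [Finite S] [Nonempty S] : (complete S).Connected := by
  refine ⟨‹Nonempty S›, fun v w => ?_⟩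
  by_cases h : v = w
  · subst h
    exact Relation.ReflTransGen.refl
  · exact Relation.ReflTransGen.single ⟨⟨(v, w), h⟩, rfl, rfl⟩

/-- The isomorphism of complete graphs induced by a bijection. -/
def completeMap {S T : Type u} [Finite S] [Finite T] (e : S ≃ T) :
    Mono (complete S) (complete T) where
  toFun := Sum.map e (fun p => ⟨(e p.1.1, e p.1.2), fun h => p.2 (e.injective h)⟩)
  map_tau := by rintro (v | h) <;> rfl
  map_bd := by rintro (v | h) <;> rfl
  injective := by
    refine Sum.map_injective.2 ⟨e.injective, ?_⟩
    rintro ⟨⟨a, b⟩, h⟩ ⟨⟨c, d⟩, k⟩ hk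
    have hk' := congrArg Subtype.val hk
    simp only [Prod.mk.injEq, EmbeddingLike.apply_eq_iff_eq] at hk'
    exact Subtype.ext (Prod.ext hk'.1 hk'.2)
  image_vertices := by
    ext x
    constructor
    · rintro ⟨_, ⟨v, rfl⟩, rfl⟩
      exact ⟨e v, rfl⟩
    · rintro ⟨w, rfl⟩
      exact ⟨_, ⟨e.symm w, rfl⟩, congrArg Sum.inl (e.apply_symm_apply w)⟩
  image_halfEdges := by
    rintro _ ⟨_, ⟨h, rfl⟩, rfl⟩
    exact ⟨_, rfl⟩

end HalfEdgeGraph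

/-- Objects of `m𝒢(r)`: connected graphs with `r + 1` vertices. -/
structure MGraph (r : ℕ) : Type (u + 1) where
  graph : HalfEdgeGraph.{u}
  connected : graph.Connected
  card_vertices : Nat.card graph.V = r + 1

/-- The category `m𝒢(r)` of connected graphs with `r + 1` vertices and graph monomorphisms. -/
instance MGraph.category (r : ℕ) : Category.{u} (MGraph.{u} r) where
  Hom G G' := HalfEdgeGraph.Mono G.graph G'.graph
  id G := HalfEdgeGraph.Mono.id G.graph
  comp f g := f.comp g

/-- Objects of `𝒮(n)`: finite sets with `n` elements. -/
structure SetOfCard (n : ℕ) : Type (u + 1) where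
  carrier : Type u
  [finite : Finite carrier]
  card_eq : Nat.card carrier = n

attribute [instance] HalfEdgeGraph.finiteV HalfEdgeGraph.finiteE SetOfCard.finite

/-- The category `𝒮(n)` of sets with `n` elements and bijections. -/
instance SetOfCard.category (n : ℕ) : Category.{u} (SetOfCard.{u} n) where
  Hom S T := S.carrier ≃ T.carrier
  id S := Equiv.refl S.carrier
  comp e f := e.trans f

/-- The vertex functor `V : m𝒢(r) ⥤ 𝒮(r + 1)`. -/
noncomputable def vertexFunctor (r : ℕ) : MGraph.{u} r ⥤ SetOfCard.{u} (r + 1) where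
  obj G := { carrier := G.graph.V, card_eq := G.card_vertices }
  map f := Equiv.ofBijective f.vertexMap f.vertexMap_bijective
  map_id _ := Equiv.ext fun _ => rfl
  map_comp f g := Equiv.ext fun v => HalfEdgeGraph.Mono.comp_vertexMap f g v

/-- The complete graph functor `K : 𝒮(r + 1) ⥤ m𝒢(r)`. -/
def completeGraphFunctor (r : ℕ) : SetOfCard.{u} (r + 1) ⥤ MGraph.{u} r where
  obj S :=
    { graph := HalfEdgeGraph.complete S.carrier
      connected :=
        have : Nonempty S.carrier := (Nat.card_pos_iff.1 (by rw [S.card_eq]; omega)).1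
        HalfEdgeGraph.complete_connected S.carrier
      card_vertices := S.card_eq }
  map e := HalfEdgeGraph.completeMap e
  map_id S := HalfEdgeGraph.Mono.ext (by funext x; rcases x with v | h <;> rfl)
  map_comp e f := HalfEdgeGraph.Mono.ext (by funext x; rcases x with v | h <;> rfl)

/-- The symmetric group `S_n`, placed in the universe `u`. -/
abbrev SymGroup (n : ℕ) : Type u := ULift.{u} (Equiv.Perm (Fin n))

/-- The one-object category of a group, with its type of objects placed in the universe `u + 1`. -/
def OneObjectCategory (G : Type u) : Type (u + 1) := ULift.{u + 1} (SingleObj G)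

instance OneObjectCategory.category (G : Type u) [Group G] :
    Category.{u} (OneObjectCategory.{u} G) :=
  uliftCategory (SingleObj G)

/-- The inclusion of `S_n` in `𝒮(n)` as the group of automorphisms of the set `{0, …, n - 1}`. -/
def symInclusion (n : ℕ) : OneObjectCategory.{u} (SymGroup.{u} n) ⥤ SetOfCard.{u} n where
  obj _ := { carrier := ULift.{u} (Fin n), card_eq := by simp }
  map σ := Equiv.ulift.symm.permCongr (ULift.down σ)
  map_id _ := Equiv.ext fun _ => rfl
  map_comp _ _ := Equiv.ext fun _ => rfl

/-- The classifying space `BC` of a category: the geometric realization of its nerve. -/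
noncomputable abbrev classifyingSpace (C : Type (u + 1)) [Category.{u} C] : TopCat.{u + 1} :=
  SSet.toTop.obj (nerve C)

/-- The continuous map `BC → BD` induced by a functor. -/
noncomputable def classifyingMap {C D : Type (u + 1)} [Category.{u} C] [Category.{u} D]
    (F : C ⥤ D) : C(classifyingSpace C, classifyingSpace D) :=
  (SSet.toTop.map (nerveMap F)).hom

/-!
A natural transformation `F ⟶ G` is a simplicial homotopy `nerve C × Δ[1] ⟶ nerve D`, which has to
be realised. By the adjunction between realisation and singular complex, it is enough to treat
`h : X × Δ[1] ⟶ Sing Z`, and then to extend `h` on each `Δ^m × Δ^1` to a continuous map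
`|Δ^m| × |Δ^1| → Z`. A point of `|Δ^m| × |Δ^n|` is a pair of distributions on finite chains; a
monotone coupling of the two (the north-west corner rule) lifts the pair to one simplex, mapped to
the product by a pair of monotone maps. The coupling with positive masses is unique, so that the
maps `h` gives on these simplices agree, and `|Δ^m| × |Δ^n|` is a compact Hausdorff quotient of
finitely many of these simplices.

The vertex functor `V` and the complete graph functor `K` satisfy `V K = 1`, while `K V` is
connected to the identity by the two natural inclusions `K(G₀) → G ∪ K(G₀) ← G`. The inclusion of
the symmetric group is an equivalence of categories.
-/

open Simplicial Opposite MonoidalCategory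

section Coupling

/-- Masses `w` on `Fin l` whose images under the monotone maps `α` and `β` are the masses `u` and
`v`: a comonotone coupling of `u` and `v`. -/
structure IsMonotoneCoupling {M : Type*} [AddCommMonoid M] [Preorder M] {l m n : ℕ}
    (α : Fin l → Fin m) (β : Fin l → Fin n) (w : Fin l → M) (u : Fin m → M) (v : Fin n → M) :
    Prop where
  monotone_left : Monotone α
  monotone_right : Monotone β
  nonneg : ∀ i, 0 ≤ w i
  sum_left : ∀ a, ∑ i with α i = a, w i = u a
  sum_right : ∀ b, ∑ i with β i = b, w i = v b

namespace IsMonotoneCoupling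

theorem symm {M : Type*} [AddCommMonoid M] [Preorder M] {l m n : ℕ} {α : Fin l → Fin m}
    {β : Fin l → Fin n} {w : Fin l → M} {u : Fin m → M} {v : Fin n → M}
    (h : IsMonotoneCoupling α β w u v) : IsMonotoneCoupling β α w v u :=
  ⟨h.monotone_right, h.monotone_left, h.nonneg, h.sum_right, h.sum_left⟩

theorem cons {M : Type*} [AddCommGroup M] [Preorder M] {l m n : ℕ}
    {α : Fin (l + 1) → Fin (m + 1)} {β : Fin (l + 1) → Fin n} {w : Fin (l + 1) → M}
    {u : Fin (m + 1) → M} {v : Fin (n + 1) → M} (hv : 0 ≤ v 0)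
    (h : IsMonotoneCoupling α β w (Fin.cons (u 0 - v 0) (Fin.tail u)) (Fin.tail v)) :
    IsMonotoneCoupling (Fin.cons 0 α) (Fin.cons 0 (Fin.succ ∘ β)) (Fin.cons (v 0) w) u v where
  monotone_left := monotone_vecCons.2 ⟨Fin.zero_le _, h.monotone_left⟩
  monotone_right :=
    monotone_vecCons.2 ⟨Fin.zero_le _, Fin.strictMono_succ.monotone.comp h.monotone_right⟩
  nonneg := Fin.cases hv h.nonneg
  sum_left a := by
    have := h.sum_left a
    rw [Finset.sum_filter] at this ⊢
    rw [Fin.sum_univ_succ]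
    simp only [Fin.cons_zero, Fin.cons_succ, this]
    cases a using Fin.cases <;> simp [Fin.tail, (Fin.succ_ne_zero _).symm]
  sum_right b := by
    rw [Finset.sum_filter, Fin.sum_univ_succ]
    cases b using Fin.cases with
    | zero => simp [Fin.succ_ne_zero]
    | succ b =>
      simpa [(Fin.succ_ne_zero _).symm, Finset.sum_filter, Fin.tail] using h.sum_right b

/-- The north-west corner rule: at each step the smaller of the two leading masses is removed
from both sides. -/
theorem exists_of_sum_eq {M : Type*} [AddCommGroup M] [LinearOrder M] [IsOrderedAddMonoid M]
    {l m n : ℕ} (hl : m + n = l) {u : Fin (m + 1) → M} {v : Fin (n + 1) → M}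
    (hu : ∀ a, 0 ≤ u a) (hv : ∀ b, 0 ≤ v b) (huv : ∑ a, u a = ∑ b, v b) :
    ∃ (α : Fin (l + 1) → Fin (m + 1)) (β : Fin (l + 1) → Fin (n + 1)) (w : Fin (l + 1) → M),
      IsMonotoneCoupling α β w u v := by
  induction l generalizing m n with
  | zero =>
    obtain ⟨rfl, rfl⟩ : m = 0 ∧ n = 0 := by omega
    obtain rfl : u = v := funext (Fin.forall_fin_one.2 (by simpa using huv))
    exact ⟨id, id, u, monotone_id, monotone_id, hu, by simp [Finset.filter_eq'],
      by simp [Finset.filter_eq']⟩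
  | succ l ih =>
    wlog hle : n ≠ 0 ∧ v 0 ≤ u 0 generalizing m n
    · have hle' : m ≠ 0 ∧ u 0 ≤ v 0 := by
        rcases n with - | n
        · rw [Fin.sum_univ_one] at huv
          exact ⟨by omega, huv ▸ Finset.single_le_sum (fun a _ => hu a) (Finset.mem_univ 0)⟩
        · have hlt : u 0 < v 0 := by simpa using hle
          refine ⟨?_, hlt.le⟩
          rintro rfl
          rw [Fin.sum_univ_one] at huv
          exact hlt.not_ge (huv ▸ Finset.single_le_sum (fun b _ => hv b) (Finset.mem_univ 0))
      obtain ⟨β, α, w, h⟩ := this (by omega) hv hu huv.symm hle'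
      exact ⟨α, β, w, h.symm⟩
    obtain ⟨hn, hle⟩ := hle
    obtain ⟨n, rfl⟩ := Nat.exists_eq_succ_of_ne_zero hn
    have huv' : ∑ a, (Fin.cons (u 0 - v 0) (Fin.tail u) : Fin (m + 1) → M) a =
        ∑ b, Fin.tail v b := by
      rw [Fin.sum_univ_succ u, Fin.sum_univ_succ v] at huv
      rw [Fin.sum_cons, sub_add_eq_add_sub]
      exact sub_eq_of_eq_add' huv
    obtain ⟨α, β, w, h⟩ := ih (by omega)
      (Fin.cases (sub_nonneg.2 hle) fun a => hu a.succ) (fun b => hv b.succ) huv'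
    exact ⟨_, _, _, h.cons (hv 0)⟩

end IsMonotoneCoupling

end Coupling

section Simplex

theorem stdSimplex_map_apply {ι κ : Type*} [Fintype ι] [Fintype κ] [DecidableEq κ] (γ : ι → κ)
    (w : stdSimplex ℝ ι) (k : κ) : stdSimplex.map γ w k = ∑ i with γ i = k, w i := by
  simp [stdSimplex.map_coe, FunOnFinite.linearMap_apply_apply]

theorem stdSimplex_map_comp {l m n : SimplexCategory} (f : l ⟶ m) (g : m ⟶ n)
    (t : stdSimplex ℝ (Fin (l.len + 1))) :
    stdSimplex.map (f ≫ g) t = stdSimplex.map g (stdSimplex.map f t) :=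
  (stdSimplex.map_comp_apply f g t).symm

theorem exists_stdSimplex_map_eq_and_map_eq {m n : SimplexCategory}
    (u : stdSimplex ℝ (Fin (m.len + 1))) (v : stdSimplex ℝ (Fin (n.len + 1))) :
    ∃ (α : ⦋m.len + n.len⦌ ⟶ m) (β : ⦋m.len + n.len⦌ ⟶ n)
      (w : stdSimplex ℝ (Fin (m.len + n.len + 1))),
      stdSimplex.map α w = u ∧ stdSimplex.map β w = v := by
  obtain ⟨α, β, w, h⟩ := IsMonotoneCoupling.exists_of_sum_eq rfl (stdSimplex.zero_le u)
    (stdSimplex.zero_le v) ((stdSimplex.sum_eq_one u).trans (stdSimplex.sum_eq_one v).symm)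
  have hw : ∑ i, w i = 1 := by
    rw [← stdSimplex.sum_eq_one u, ← Finset.sum_fiberwise Finset.univ α w]
    exact Finset.sum_congr rfl fun a _ => h.sum_left a
  refine ⟨SimplexCategory.Hom.mk ⟨α, h.monotone_left⟩, SimplexCategory.Hom.mk ⟨β, h.monotone_right⟩,
    ⟨w, h.nonneg, hw⟩, ?_, ?_⟩
  · ext a
    exact (stdSimplex_map_apply _ _ a).trans (h.sum_left a)
  · ext b
    exact (stdSimplex_map_apply _ _ b).trans (h.sum_right b)

theorem exists_pos_stdSimplex_map_eq {n : SimplexCategory}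
    (w : stdSimplex ℝ (Fin (n.len + 1))) :
    ∃ (l : SimplexCategory) (δ : l ⟶ n) (w' : stdSimplex ℝ (Fin (l.len + 1))),
      (∀ i, 0 < w' i) ∧ stdSimplex.map δ w' = w := by
  let S : Finset (Fin (n.len + 1)) := {i | 0 < w i}
  have hS : ∑ i ∈ S, w i = 1 := by
    rw [← stdSimplex.sum_eq_one w, Finset.sum_filter_of_ne]
    exact fun i _ hi => (stdSimplex.zero_le w i).lt_of_ne' hi
  have hcard : S.card = S.card - 1 + 1 :=
    (Nat.succ_pred (Finset.card_ne_zero.2 (Finset.nonempty_of_sum_ne_zero (hS ▸ one_ne_zero)))).symm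
  let e := S.orderEmbOfFin hcard
  have hsum (f : Fin (n.len + 1) → ℝ) : ∑ i, f (e i) = ∑ j ∈ S, f j := by
    conv_rhs => rw [← S.map_orderEmbOfFin_univ hcard, Finset.sum_map]
    rfl
  refine ⟨⦋S.card - 1⦌, SimplexCategory.Hom.mk e.toOrderHom,
    ⟨fun i => w (e i), fun i => stdSimplex.zero_le w _, (hsum w).trans hS⟩,
    fun i => (Finset.mem_filter.1 (S.orderEmbOfFin_mem hcard i)).2, ?_⟩
  ext a
  calc _ = ∑ i with e i = a, w (e i) := stdSimplex_map_apply _ _ a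
    _ = ∑ j ∈ S, if j = a then w j else 0 := by
      rw [Finset.sum_filter, hsum fun j => if j = a then w j else 0]
    _ = w a := by
      rw [Finset.sum_ite_eq', ite_eq_left_iff, Finset.mem_filter_univ, not_lt]
      exact fun ha => (stdSimplex.zero_le w a).antisymm ha

theorem sum_filter_le_eq_sum_stdSimplex_map {ι κ : Type*} [Fintype ι] [Fintype κ] [LinearOrder κ]
    (γ : ι → κ) (w : stdSimplex ℝ ι) (a : κ) :
    ∑ i with γ i ≤ a, w i = ∑ b with b ≤ a, stdSimplex.map γ w b := by
  simp only [stdSimplex_map_apply, Finset.sum_fiberwise_eq_sum_filter, Finset.mem_filter_univ]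

theorem eq_of_stdSimplex_map_eq {ι κ : Type*} [Fintype ι] [LinearOrder ι] [Fintype κ]
    [LinearOrder κ] {γ γ' : ι → κ} (hγ : Monotone γ) (hγ' : Monotone γ') {w : stdSimplex ℝ ι}
    (hw : ∀ i, 0 < w i) (h : stdSimplex.map γ w = stdSimplex.map γ' w) : γ = γ' := by
  by_contra hne
  obtain ⟨i, hi⟩ := Function.ne_iff.1 hne
  wlog hlt : γ i < γ' i generalizing γ γ'
  · exact this hγ' hγ h.symm (Ne.symm hne) hi.symm (hi.lt_or_gt.resolve_left hlt)
  have hsub : Finset.univ.filter (γ' · ≤ γ i) ⊆ Finset.univ.filter (γ · ≤ γ i) := by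
    intro j hj
    rw [Finset.mem_filter_univ] at hj ⊢
    exact hγ (hγ'.reflect_lt (hj.trans_lt hlt)).le
  have hmass : ∑ j with γ' j ≤ γ i, w j < ∑ j with γ j ≤ γ i, w j :=
    Finset.sum_lt_sum_of_subset hsub (Finset.mem_filter.2 ⟨Finset.mem_univ i, le_rfl⟩)
      (by simpa using hlt) (hw i) fun j _ _ => (hw j).le
  rw [sum_filter_le_eq_sum_stdSimplex_map γ, sum_filter_le_eq_sum_stdSimplex_map γ', h] at hmass
  exact hmass.false

theorem exists_pos_stdSimplex_map_eq_and_map_eq {m n : SimplexCategory}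
    (u : stdSimplex ℝ (Fin (m.len + 1))) (v : stdSimplex ℝ (Fin (n.len + 1))) :
    ∃ (l : SimplexCategory) (α : l ⟶ m) (β : l ⟶ n) (w : stdSimplex ℝ (Fin (l.len + 1))),
      (∀ i, 0 < w i) ∧ stdSimplex.map α w = u ∧ stdSimplex.map β w = v := by
  obtain ⟨α, β, w, rfl, rfl⟩ := exists_stdSimplex_map_eq_and_map_eq u v
  obtain ⟨l, δ, w, hw, rfl⟩ := exists_pos_stdSimplex_map_eq w
  exact ⟨l, δ ≫ α, δ ≫ β, w, hw, stdSimplex_map_comp δ α w, stdSimplex_map_comp δ β w⟩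

end Simplex

section ProductOfSimplices

variable {m n : SimplexCategory} {Z : Type*} [TopologicalSpace Z]
  {φ : ∀ l : SimplexCategory, (l ⟶ m) → (l ⟶ n) → C(stdSimplex ℝ (Fin (l.len + 1)), Z)}

theorem apply_eq_of_stdSimplex_map_eq
    (hφ : ∀ (l l' : SimplexCategory) (f : l ⟶ l') α β t,
      φ l (f ≫ α) (f ≫ β) t = φ l' α β (stdSimplex.map f t))
    {l l' : SimplexCategory} {α : l ⟶ m} {β : l ⟶ n} {α' : l' ⟶ m} {β' : l' ⟶ n}
    {t : stdSimplex ℝ (Fin (l.len + 1))} {t' : stdSimplex ℝ (Fin (l'.len + 1))}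
    (hα : stdSimplex.map α t = stdSimplex.map α' t')
    (hβ : stdSimplex.map β t = stdSimplex.map β' t') : φ l α β t = φ l' α' β' t' := by
  obtain ⟨k, g, g', w, hw, rfl, rfl⟩ := exists_pos_stdSimplex_map_eq_and_map_eq t t'
  have comp_eq {j : SimplexCategory} {γ : l ⟶ j} {γ' : l' ⟶ j}
      (h : stdSimplex.map γ (stdSimplex.map g w) = stdSimplex.map γ' (stdSimplex.map g' w)) :
      g ≫ γ = g' ≫ γ' := by
    rw [← stdSimplex_map_comp, ← stdSimplex_map_comp] at h
    exact SimplexCategory.Hom.ext _ _ (OrderHom.ext _ _ (eq_of_stdSimplex_map_eq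
      (g ≫ γ).toOrderHom.monotone (g' ≫ γ').toOrderHom.monotone hw h))
  rw [← hφ, ← hφ, comp_eq hα, comp_eq hβ]

theorem exists_continuousMap_prod_stdSimplex
    (hφ : ∀ (l l' : SimplexCategory) (f : l ⟶ l') α β t,
      φ l (f ≫ α) (f ≫ β) t = φ l' α β (stdSimplex.map f t)) :
    ∃ G : C(stdSimplex ℝ (Fin (m.len + 1)) × stdSimplex ℝ (Fin (n.len + 1)), Z),
      ∀ (l : SimplexCategory) (α : l ⟶ m) (β : l ⟶ n) (t : stdSimplex ℝ (Fin (l.len + 1))),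
        G (stdSimplex.map α t, stdSimplex.map β t) = φ l α β t := by
  let q : (Σ _ : (⦋m.len + n.len⦌ ⟶ m) × (⦋m.len + n.len⦌ ⟶ n),
      stdSimplex ℝ (Fin (m.len + n.len + 1))) →
      stdSimplex ℝ (Fin (m.len + 1)) × stdSimplex ℝ (Fin (n.len + 1)) :=
    fun p => (stdSimplex.map p.1.1 p.2, stdSimplex.map p.1.2 p.2)
  have hq : Continuous q := continuous_sigma fun p =>
    (stdSimplex.continuous_map p.1).prodMk (stdSimplex.continuous_map p.2)
  have hq_surj : Function.Surjective q := fun ⟨u, v⟩ => by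
    obtain ⟨α, β, w, rfl, rfl⟩ := exists_stdSimplex_map_eq_and_map_eq u v
    exact ⟨⟨(α, β), w⟩, rfl⟩
  have hq_quot : Topology.IsQuotientMap (⟨q, hq⟩ : C(_, _)) :=
    hq.isClosedMap.isQuotientMap hq hq_surj
  let g : C(Σ _ : (⦋m.len + n.len⦌ ⟶ m) × (⦋m.len + n.len⦌ ⟶ n),
      stdSimplex ℝ (Fin (m.len + n.len + 1)), Z) :=
    ⟨fun p => φ _ p.1.1 p.1.2 p.2, continuous_sigma fun p => (φ _ p.1 p.2).continuous⟩
  have hg : Function.FactorsThrough g q := fun p p' h =>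
    apply_eq_of_stdSimplex_map_eq hφ (congrArg Prod.fst h) (congrArg Prod.snd h)
  refine ⟨hq_quot.lift g hg, fun l α β t => ?_⟩
  obtain ⟨⟨⟨α', β'⟩, t'⟩, h⟩ := hq_surj (stdSimplex.map α t, stdSimplex.map β t)
  rw [← h]
  exact (ContinuousMap.congr_fun (hq_quot.lift_comp g hg) ⟨(α', β'), t'⟩).trans
    (apply_eq_of_stdSimplex_map_eq hφ (congrArg Prod.fst h) (congrArg Prod.snd h))

end ProductOfSimplices

section CrossMap

variable {X Y : SSet.{u}} {Z : TopCat.{u}} (h : X ⊗ Y ⟶ TopCat.toSSet.obj Z)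

theorem toSSetObjEquiv_map {m n : SimplexCategory} (f : m ⟶ n)
    (z : (TopCat.toSSet.obj Z).obj (op n)) (t : stdSimplex ℝ (Fin (m.len + 1))) :
    TopCat.toSSetObjEquiv Z (op m) ((TopCat.toSSet.obj Z).map f.op z) t =
      TopCat.toSSetObjEquiv Z (op n) z (stdSimplex.map f t) :=
  rfl

theorem exists_crossMap {m n : SimplexCategory} (x : X.obj (op m)) (y : Y.obj (op n)) :
    ∃ G : C(stdSimplex ℝ (Fin (m.len + 1)) × stdSimplex ℝ (Fin (n.len + 1)), Z),
      ∀ (l : SimplexCategory) (α : l ⟶ m) (β : l ⟶ n) (t : stdSimplex ℝ (Fin (l.len + 1))),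
        G (stdSimplex.map α t, stdSimplex.map β t) =
          TopCat.toSSetObjEquiv Z (op l) (h.app (op l) (X.map α.op x, Y.map β.op y)) t := by
  refine exists_continuousMap_prod_stdSimplex fun l l' f α β t => ?_
  rw [← toSSetObjEquiv_map]
  have hxy : ((X.map (f ≫ α).op x, Y.map (f ≫ β).op y) : (X ⊗ Y).obj (op l)) =
      (X ⊗ Y).map f.op (X.map α.op x, Y.map β.op y) :=
    Prod.ext (X.map_comp_apply _ _ x) (Y.map_comp_apply _ _ y)
  exact congrArg (TopCat.toSSetObjEquiv Z (op l) · t)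
    ((congrArg (h.app (op l)) hxy).trans (NatTrans.naturality_apply h f.op _))

/-- The map `|Δ[m]| × |Δ[n]| → Z` that a simplicial map `h : X × Y → Sing Z` assigns to simplices
`x` of `X` and `y` of `Y`. It is characterised by `crossMap_map_map`. -/
noncomputable def crossMap {m n : SimplexCategory} (x : X.obj (op m)) (y : Y.obj (op n)) :
    C(stdSimplex ℝ (Fin (m.len + 1)) × stdSimplex ℝ (Fin (n.len + 1)), Z) :=
  (exists_crossMap h x y).choose

theorem crossMap_map_map {l m n : SimplexCategory} (x : X.obj (op m)) (y : Y.obj (op n))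
    (α : l ⟶ m) (β : l ⟶ n) (t : stdSimplex ℝ (Fin (l.len + 1))) :
    crossMap h x y (stdSimplex.map α t, stdSimplex.map β t) =
      TopCat.toSSetObjEquiv Z (op l) (h.app (op l) (X.map α.op x, Y.map β.op y)) t :=
  (exists_crossMap h x y).choose_spec l α β t

theorem crossMap_naturality {m m' n n' : SimplexCategory} (f : m' ⟶ m) (g : n' ⟶ n)
    (x : X.obj (op m)) (y : Y.obj (op n)) (s : stdSimplex ℝ (Fin (m'.len + 1)))
    (t : stdSimplex ℝ (Fin (n'.len + 1))) :
    crossMap h (X.map f.op x) (Y.map g.op y) (s, t) =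
      crossMap h x y (stdSimplex.map f s, stdSimplex.map g t) := by
  obtain ⟨α, β, w, rfl, rfl⟩ := exists_stdSimplex_map_eq_and_map_eq s t
  rw [← stdSimplex_map_comp, ← stdSimplex_map_comp, crossMap_map_map, crossMap_map_map]
  congr 3
  exact Prod.ext (X.map_comp_apply _ _ x).symm
    (Y.map_comp_apply _ _ y).symm

/-- The simplicial map `X → Sing C(|Δ[n]|, Z)` obtained by currying `h : X × Y → Sing Z` at an
`n`-simplex of `Y`. -/
noncomputable def singularCurry {n : SimplexCategory} (y : Y.obj (op n)) :
    X ⟶ TopCat.toSSet.obj (TopCat.of C(stdSimplex ℝ (Fin (n.len + 1)), Z)) where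
  app m := ↾fun x => (TopCat.toSSetObjEquiv _ m).symm (crossMap h (m := m.unop) x y).curry
  naturality m m' f := by
    ext x
    apply (TopCat.toSSetObjEquiv _ m').injective
    ext t s
    have := crossMap_naturality h f.unop (𝟙 n) x y t s
    rw [op_id, Y.map_id_apply, Quiver.Hom.op_unop] at this
    exact this.trans (congrArg (crossMap h x y) (Prod.ext rfl (stdSimplex.map_id_apply s)))

end CrossMap

section Homotopy

/-- Evaluation at the `i`-th vertex of a topological simplex. -/
def evalVertex (Z : Type*) [TopologicalSpace Z] {n : ℕ} (i : Fin n) :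
    C(C(stdSimplex ℝ (Fin n), Z), Z) :=
  ⟨fun f => f (stdSimplex.vertex i), continuous_eval_const _⟩

theorem evalVertex_homotopic (Z : Type*) [TopologicalSpace Z] {n : ℕ} (i j : Fin n) :
    (evalVertex Z i).Homotopic (evalVertex Z j) := by
  have : PathConnectedSpace (stdSimplex ℝ (Fin n)) := isPathConnected_iff_pathConnectedSpace.1
    ((convex_stdSimplex ℝ (Fin n)).isPathConnected ⟨_, (stdSimplex.vertex i).2⟩)
  let γ := PathConnectedSpace.somePath (stdSimplex.vertex i : stdSimplex ℝ (Fin n))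
    (stdSimplex.vertex j)
  exact ⟨{
    toFun := fun p => p.2 (γ p.1)
    continuous_toFun := by fun_prop
    map_zero_left := fun f => congrArg f γ.source
    map_one_left := fun f => congrArg f γ.target }⟩

theorem stdSimplex_map_const {ι κ : Type*} [Fintype ι] [Fintype κ] [DecidableEq κ]
    (t : stdSimplex ℝ ι) (k : κ) : stdSimplex.map (fun _ => k) t = stdSimplex.vertex k := by
  ext k'
  rw [stdSimplex_map_apply, stdSimplex.vertex_coe, Pi.single_apply, Finset.sum_filter]
  by_cases h : k = k'
  · simp [h, stdSimplex.sum_eq_one]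
  · simp [h, Ne.symm h]

variable {X Y : SSet.{u}} {Z : TopCat.{u}}

theorem crossMap_vertex (h : X ⊗ Y ⟶ TopCat.toSSet.obj Z) {m n : SimplexCategory}
    (x : X.obj (op m)) (y : Y.obj (op n)) (t : stdSimplex ℝ (Fin (m.len + 1)))
    (i : Fin (n.len + 1)) :
    crossMap h x y (t, stdSimplex.vertex i) =
      TopCat.toSSetObjEquiv Z (op m) (h.app (op m) (x, Y.map (m.const n i).op y)) t := by
  have := crossMap_map_map h x y (𝟙 m) (m.const n i) t
  rw [op_id, X.map_id_apply] at this
  rw [← this]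
  congr 2
  · exact (stdSimplex.map_id_apply t).symm
  · exact (stdSimplex_map_const t i).symm

theorem singularCurry_comp_evalVertex (h : X ⊗ Y ⟶ TopCat.toSSet.obj Z) {n : SimplexCategory}
    (y : Y.obj (op n)) (i : Fin (n.len + 1)) {f : X ⟶ TopCat.toSSet.obj Z}
    (hf : ∀ (m : SimplexCategory) (x : X.obj (op m)),
      h.app (op m) (x, Y.map (m.const n i).op y) = f.app (op m) x) :
    singularCurry h y ≫ TopCat.toSSet.map (TopCat.ofHom (evalVertex Z i)) = f := by
  ext m x
  apply (TopCat.toSSetObjEquiv Z m).injective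
  ext t
  exact (crossMap_vertex h x y t i).trans
    (congrArg (TopCat.toSSetObjEquiv Z m · t) (hf m.unop x))

theorem homotopic_homEquiv_symm (h : X ⊗ Δ[1] ⟶ TopCat.toSSet.obj Z) :
    ((sSetTopAdj.homEquiv X Z).symm (SSet.ι₀ ≫ h)).hom.Homotopic
      ((sSetTopAdj.homEquiv X Z).symm (SSet.ι₁ ≫ h)).hom := by
  let y : (Δ[1] : SSet.{u}).obj (op ⦋1⦌) := SSet.stdSimplex.objEquiv.symm (𝟙 _)
  have h₀ : singularCurry h y ≫ TopCat.toSSet.map (TopCat.ofHom (evalVertex Z 0)) =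
      SSet.ι₀ ≫ h := singularCurry_comp_evalVertex h y 0 fun _ _ => rfl
  have h₁ : singularCurry h y ≫ TopCat.toSSet.map (TopCat.ofHom (evalVertex Z 1)) =
      SSet.ι₁ ≫ h := singularCurry_comp_evalVertex h y 1 fun _ _ => rfl
  rw [← h₀, ← h₁, Adjunction.homEquiv_naturality_right_symm,
    Adjunction.homEquiv_naturality_right_symm]
  exact (evalVertex_homotopic Z 0 1).comp (.refl _)

theorem toTop_map_eq_homEquiv_symm (f : X ⟶ Y) :
    SSet.toTop.map f = (sSetTopAdj.homEquiv X (SSet.toTop.obj Y)).symm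
      (f ≫ sSetTopAdj.unit.app Y) := by
  rw [Adjunction.homEquiv_naturality_left_symm, Adjunction.homEquiv_symm_unit, Category.comp_id]

theorem toTop_map_homotopic {f g : X ⟶ Y} (H : SSet.Homotopy f g) :
    (SSet.toTop.map f).hom.Homotopic (SSet.toTop.map g).hom := by
  have homotopic_adjuncts := homotopic_homEquiv_symm (H.h ≫ sSetTopAdj.unit.app Y)
  rw [← Category.assoc, ← Category.assoc, H.h₀, H.h₁] at homotopic_adjuncts
  rwa [toTop_map_eq_homEquiv_symm f, toTop_map_eq_homEquiv_symm g]

end Homotopy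

section NaturalTransformation

universe v w

variable {C D : Type v} [Category.{w} C] [Category.{w} D] {F G : C ⥤ D}

/-- The simplex of `nerve D` given by `i ↦ F (x i)` for `β i = 0` and `i ↦ G (x i)` for `β i = 1`,
the two parts being joined by a natural transformation `α : F ⟶ G`. -/
def nerveGlue (α : F ⟶ G) {n : SimplexCategory} (x : (nerve C).obj (op n)) (β : n ⟶ ⦋1⦌) :
    (nerve D).obj (op n) :=
  Functor.prod' (β.toOrderHom.monotone.functor ⋙ ComposableArrows.mk₁ α) x ⋙
    Functor.uncurry.obj (𝟭 (C ⥤ D))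

theorem nerveGlue_const_zero (α : F ⟶ G) {n : SimplexCategory} (x : (nerve C).obj (op n)) :
    nerveGlue α x (n.const ⦋1⦌ 0) = (nerveMap F).app (op n) x := by
  refine CategoryTheory.Functor.ext (fun _ => rfl) fun i j f => ?_
  change 𝟙 _ ≫ F.map _ = 𝟙 _ ≫ F.map _ ≫ 𝟙 _
  rw [Category.comp_id]
  rfl

theorem nerveGlue_const_one (α : F ⟶ G) {n : SimplexCategory} (x : (nerve C).obj (op n)) :
    nerveGlue α x (n.const ⦋1⦌ 1) = (nerveMap G).app (op n) x := by
  refine CategoryTheory.Functor.ext (fun _ => rfl) fun i j f => ?_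
  change 𝟙 _ ≫ G.map _ = 𝟙 _ ≫ G.map _ ≫ 𝟙 _
  rw [Category.comp_id]
  rfl

/-- The simplicial homotopy between nerve maps given by a natural transformation. -/
def nerveHomotopy (α : F ⟶ G) : SSet.Homotopy (nerveMap F) (nerveMap G) where
  h := { app n := ↾fun p => nerveGlue α p.1 (SSet.stdSimplex.objEquiv p.2) }
  h₀ := by
    ext n x
    exact nerveGlue_const_zero α x
  h₁ := by
    ext n x
    exact nerveGlue_const_one α x
  rel := by ext _ ⟨⟨_, ⟨⟩⟩, _⟩

end NaturalTransformation

section ClassifyingSpace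

variable {C D E : Type (u + 1)} [Category.{u} C] [Category.{u} D] [Category.{u} E]

theorem classifyingMap_id : classifyingMap (𝟭 C) = ContinuousMap.id (classifyingSpace C) :=
  congrArg TopCat.Hom.hom (SSet.toTop.map_id (nerve C))

theorem classifyingMap_comp (F : C ⥤ D) (G : D ⥤ E) :
    classifyingMap (F ⋙ G) = (classifyingMap G).comp (classifyingMap F) :=
  congrArg TopCat.Hom.hom (SSet.toTop.map_comp (nerveMap F) (nerveMap G))

theorem classifyingMap_homotopic {F G : C ⥤ D} (α : F ⟶ G) :
    (classifyingMap F).Homotopic (classifyingMap G) :=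
  toTop_map_homotopic (nerveHomotopy α)

/-- The homotopy equivalence of classifying spaces given by two functors whose composites induce
maps homotopic to those of the identity functors; the functors need not be adjoint. -/
noncomputable def classifyingHomotopyEquiv (F : C ⥤ D) (G : D ⥤ C)
    (hFG : (classifyingMap (F ⋙ G)).Homotopic (classifyingMap (𝟭 C)))
    (hGF : (classifyingMap (G ⋙ F)).Homotopic (classifyingMap (𝟭 D))) :
    classifyingSpace C ≃ₕ classifyingSpace D where
  toFun := classifyingMap F
  invFun := classifyingMap G
  left_inv := by rwa [← classifyingMap_comp, ← classifyingMap_id]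
  right_inv := by rwa [← classifyingMap_comp, ← classifyingMap_id]

end ClassifyingSpace

section SymmetricGroup

instance symInclusion_full (n : ℕ) : (symInclusion.{u} n).Full where
  map_surjective e := ⟨ULift.up (Equiv.ulift.permCongr e), Equiv.ext fun _ => rfl⟩

instance symInclusion_faithful (n : ℕ) : (symInclusion.{u} n).Faithful where
  map_injective h := ULift.ext _ _ (Equiv.ulift.symm.permCongr.injective h)

instance symInclusion_essSurj (n : ℕ) : (symInclusion.{u} n).EssSurj where
  mem_essImage S :=
    have e : ULift.{u} (Fin n) ≃ S.carrier :=
      Equiv.ulift.trans (Finite.equivFinOfCardEq S.card_eq).symm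
    ⟨ULift.up (SingleObj.star _), ⟨{
      hom := e
      inv := e.symm
      hom_inv_id := e.self_trans_symm
      inv_hom_id := e.symm_trans_self }⟩⟩

instance symInclusion_isEquivalence (n : ℕ) : (symInclusion.{u} n).IsEquivalence where

end SymmetricGroup

namespace HalfEdgeGraph

namespace Mono

variable {G G' G'' : HalfEdgeGraph.{u}}

/-- The bijection of vertices underlying a monomorphism. -/
noncomputable def vertexEquiv (f : Mono G G') : G.V ≃ G'.V :=
  Equiv.ofBijective f.vertexMap f.vertexMap_bijective

theorem isRight_toFun_inr (f : Mono G G') (h : G.H) : (f.toFun (Sum.inr h)).isRight := by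
  obtain ⟨k, hk⟩ := f.image_halfEdges ⟨_, ⟨h, rfl⟩, rfl⟩
  rw [← hk, Sum.isRight_inr]

/-- The map on half-edges underlying a monomorphism. -/
def halfEdgeMap (f : Mono G G') (h : G.H) : G'.H :=
  (f.toFun (Sum.inr h)).getRight (f.isRight_toFun_inr h)

theorem toFun_inr (f : Mono G G') (h : G.H) :
    f.toFun (Sum.inr h) = Sum.inr (f.halfEdgeMap h) :=
  (Sum.inr_getRight _ _).symm

theorem halfEdgeMap_injective (f : Mono G G') : Function.Injective f.halfEdgeMap := by
  intro h k e
  apply Sum.inr_injective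
  apply f.injective
  rw [toFun_inr, toFun_inr, e]

theorem halfEdgeMap_tau (f : Mono G G') (h : G.H) :
    f.halfEdgeMap (G.tau h) = G'.tau (f.halfEdgeMap h) := by
  have e := f.map_tau (Sum.inr h)
  rw [toFun_inr] at e
  exact Sum.inr_injective ((f.toFun_inr (G.tau h)).symm.trans e)

theorem bd_halfEdgeMap (f : Mono G G') (h : G.H) :
    G'.bd (f.halfEdgeMap h) = f.vertexEquiv (G.bd h) := by
  have e := f.map_bd (Sum.inr h)
  rw [toFun_inr] at e
  exact (Sum.inl_injective ((f.toFun_inl (G.bd h)).symm.trans e)).symm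

theorem halfEdgeMap_comp (f : Mono G G') (g : Mono G' G'') (h : G.H) :
    (f.comp g).halfEdgeMap h = g.halfEdgeMap (f.halfEdgeMap h) := by
  apply Sum.inr_injective
  rw [← toFun_inr, ← toFun_inr, ← toFun_inr]
  rfl

/-- The monomorphism given by a bijection of vertices and a compatible injection of half-edges. -/
def ofMaps (e : G.V ≃ G'.V) (k : G.H → G'.H) (hk : Function.Injective k)
    (k_tau : ∀ h, k (G.tau h) = G'.tau (k h)) (bd_k : ∀ h, G'.bd (k h) = e (G.bd h)) :
    Mono G G' where
  toFun := Sum.map e k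
  map_tau := by
    rintro (v | h)
    · rfl
    · exact congrArg Sum.inr (k_tau h)
  map_bd := by
    rintro (v | h)
    · rfl
    · exact congrArg Sum.inl (bd_k h).symm
  injective := Sum.map_injective.2 ⟨e.injective, hk⟩
  image_vertices := by
    rw [← Set.range_comp]
    exact e.surjective.range_comp Sum.inl
  image_halfEdges := by
    rw [← Set.range_comp]
    exact Set.range_comp_subset_range k Sum.inr

end Mono

/-- The graph obtained from `G` by adding one more edge between any two distinct vertices: the
union, along the vertices, of `G` and the complete graph on its vertices. -/
def addComplete (G : HalfEdgeGraph.{u}) : HalfEdgeGraph.{u} where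
  V := G.V
  E := G.E ⊕ (complete G.V).E
  H := G.H ⊕ (complete G.V).H
  finiteE := inferInstance
  edge := Sum.map G.edge (complete G.V).edge
  edge_surjective := Sum.map_surjective.2 ⟨G.edge_surjective, (complete G.V).edge_surjective⟩
  tau := Sum.map G.tau (complete G.V).tau
  edge_tau := by
    rintro (h | h)
    · exact congrArg Sum.inl (G.edge_tau h)
    · exact congrArg Sum.inr ((complete G.V).edge_tau h)
  tau_ne := by
    rintro (h | h) e
    · exact G.tau_ne h (Sum.inl_injective e)
    · exact (complete G.V).tau_ne h (Sum.inr_injective e)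
  eq_or_eq_tau := by
    rintro (h | h) (k | k) e
    · exact (G.eq_or_eq_tau h k (Sum.inl_injective e)).imp (congrArg _) (congrArg _)
    · cases e
    · cases e
    · exact ((complete G.V).eq_or_eq_tau h k (Sum.inr_injective e)).imp (congrArg _) (congrArg _)
  bd := Sum.elim G.bd (complete G.V).bd

theorem Connected.addComplete {G : HalfEdgeGraph.{u}} (h : G.Connected) :
    G.addComplete.Connected :=
  ⟨h.1, fun v w => Relation.ReflTransGen.mono
    (fun _ _ ⟨k, h₁, h₂⟩ => ⟨Sum.inl k, h₁, h₂⟩) v w (h.2 v w)⟩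

namespace Mono

variable {G G' : HalfEdgeGraph.{u}}

/-- The monomorphism of graphs with added complete graphs induced by a monomorphism. -/
noncomputable def addComplete (f : Mono G G') : Mono G.addComplete G'.addComplete :=
  ofMaps f.vertexEquiv (Sum.map f.halfEdgeMap (completeMap f.vertexEquiv).halfEdgeMap)
    (Sum.map_injective.2 ⟨f.halfEdgeMap_injective, halfEdgeMap_injective _⟩)
    (by
      rintro (h | h)
      · exact congrArg Sum.inl (f.halfEdgeMap_tau h)
      · exact congrArg Sum.inr (halfEdgeMap_tau _ h))
    (by
      rintro (h | h)
      · exact f.bd_halfEdgeMap h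
      · rfl)

/-- The inclusion of `G` into `G.addComplete`. -/
def toAddComplete (G : HalfEdgeGraph.{u}) : Mono G G.addComplete :=
  ofMaps (Equiv.refl G.V) Sum.inl Sum.inl_injective (fun _ => rfl) fun _ => rfl

/-- The inclusion of the complete graph on the vertices of `G` into `G.addComplete`. -/
def completeToAddComplete (G : HalfEdgeGraph.{u}) : Mono (complete G.V) G.addComplete :=
  ofMaps (Equiv.refl G.V) Sum.inr Sum.inr_injective (fun _ => rfl) fun _ => rfl

end Mono

end HalfEdgeGraph

section VertexFunctor

open HalfEdgeGraph

/-- The endofunctor `G ↦ G.addComplete` of `m𝒢(r)`. -/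
noncomputable def addCompleteFunctor (r : ℕ) : MGraph.{u} r ⥤ MGraph.{u} r where
  obj G := ⟨G.graph.addComplete, G.connected.addComplete, G.card_vertices⟩
  map f := Mono.addComplete f
  map_id G := Mono.ext <| funext <| by rintro (v | h | h) <;> rfl
  map_comp f g := Mono.ext <| funext <| by
    rintro (v | h | h)
    · exact congrArg Sum.inl (Mono.comp_vertexMap f g v)
    · exact congrArg (Sum.inr ∘ Sum.inl) (Mono.halfEdgeMap_comp f g h)
    · exact congrArg (Sum.inr ∘ Sum.inr) <| Subtype.ext <|
        Prod.ext (Mono.comp_vertexMap f g _) (Mono.comp_vertexMap f g _)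

/-- The inclusions `G ⟶ G.addComplete` form a natural transformation. -/
def toAddCompleteNatTrans (r : ℕ) : 𝟭 (MGraph.{u} r) ⟶ addCompleteFunctor.{u} r where
  app G := Mono.toAddComplete G.graph
  naturality _ _ f := Mono.ext <| funext <| by
    rintro (v | h)
    · exact congrArg _ (Mono.toFun_inl f v)
    · exact congrArg _ (Mono.toFun_inr f h)

/-- The inclusions of the complete graphs on the vertices form a natural transformation. -/
def completeToAddCompleteNatTrans (r : ℕ) :
    vertexFunctor.{u} r ⋙ completeGraphFunctor.{u} r ⟶ addCompleteFunctor.{u} r where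
  app G := Mono.completeToAddComplete G.graph
  naturality _ _ _ := Mono.ext <| funext <| by rintro (v | h) <;> rfl

theorem classifyingMap_vertexFunctor_comp_completeGraphFunctor_homotopic (r : ℕ) :
    (classifyingMap (vertexFunctor.{u} r ⋙ completeGraphFunctor.{u} r)).Homotopic
      (classifyingMap (𝟭 (MGraph.{u} r))) :=
  (classifyingMap_homotopic (completeToAddCompleteNatTrans r)).trans
    (classifyingMap_homotopic (toAddCompleteNatTrans r)).symm

/-- The vertex set of the complete graph on `S` is `S` itself. -/
noncomputable def completeGraphFunctorCompVertexFunctorIso (r : ℕ) :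
    completeGraphFunctor.{u} r ⋙ vertexFunctor.{u} r ≅ 𝟭 (SetOfCard.{u} (r + 1)) :=
  NatIso.ofComponents (fun S => Iso.refl S) fun _ => Equiv.ext fun _ => rfl

end VertexFunctor

theorem mainTheorem10 (r : ℕ) :
    (∃ h : classifyingSpace (MGraph.{u} r) ≃ₕ classifyingSpace (SetOfCard.{u} (r + 1)),
      h.toFun = classifyingMap (vertexFunctor.{u} r) ∧
      h.invFun = classifyingMap (completeGraphFunctor.{u} r)) ∧
    (∃ h : classifyingSpace (SetOfCard.{u} (r + 1)) ≃ₕ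
        classifyingSpace (OneObjectCategory.{u} (SymGroup.{u} (r + 1))),
      h.invFun = classifyingMap (symInclusion.{u} (r + 1))) := by
  let e := (symInclusion.{u} (r + 1)).asEquivalence
  let vertexEquivalence := classifyingHomotopyEquiv (vertexFunctor.{u} r) (completeGraphFunctor r)
    (classifyingMap_vertexFunctor_comp_completeGraphFunctor_homotopic r)
    (classifyingMap_homotopic (completeGraphFunctorCompVertexFunctorIso r).hom)
  let symEquivalence := classifyingHomotopyEquiv e.functor e.inverse
    (classifyingMap_homotopic e.unitIso.inv) (classifyingMap_homotopic e.counitIso.hom)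
  exact ⟨⟨vertexEquivalence, rfl, rfl⟩, ⟨symEquivalence.symm, rfl⟩⟩
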